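/- Consider $n$ anonymous agents that communicate in synchronous rounds. A dynamic network of size $n$ is a sequence $(G_t)_{t\ge 1}$ of undirected multigraphs on the set of agents; it is connected if every $G_t$ is connected. Each agent has an input from a set $I$, which it can always read, and an internal state. All agents run the same deterministic local algorithm, which prescribes an initial state for each input. At round $t\ge1$ each agent sends a message, a function of its input and its state, through all its links in $G_t$, and computes its new state from its input, its state and the multiset of messages received. The output at the end of a round is a function of the input and the state. The Input Frequency function maps an input assignment $x$ to the function $a\mapsto |\{p : x(p)=a\}|/n$ on $I$. Theorem. There is a function $f:\mathbb N^3\to\mathbb N$ such that for every $n\ge 1$ and every set $I$ of inputs there is a local algorithm with the following properties. 1. (Universal, self-stabilizing, stabilization in $2n-2$ rounds.) In every connected dynamic network of size $n$, for all inputs in $I$ and for arbitrary initial states of the agents, at the end of every round $t\ge 2n-2$ every agent outputs the Input Frequency function of the inputs. 2. (Finite-state.) For every $M\in\mathbb N$ and every finite $J\subseteq I$ there is a set $F$ of states, each encodable (injectively) by at most $f(n,M,|J|)$ bits, that contains the prescribed initial states for the inputs in $J$ and is such that, in every connected dynamic network of size $n$ in which any two agents are joined by at most $M$ parallel links per round,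 and for all inputs in $J$: if all initial states are in $F$, then all states are in $F$ at all rounds; and for arbitrary initial states, all states are in $F$ at all rounds $t\ge 2n-2$. -/

import Mathlib

universe u

namespace AnonymousNetwork

/-- A finite undirected multigraph on the agents `V`: a multiset of links. Parallel links and
loops are allowed; `E.count s(p, q)` is the number of parallel links between `p` and `q`. -/
abbrev Multigraph (V : Type) : Type := Multiset (Sym2 V)

/-- Two distinct agents are adjacent if at least one link joins them. -/
def Multigraph.toSimpleGraph {V : Type} (E : Multigraph V) : SimpleGraph V :=
  SimpleGraph.fromRel fun p q => s(p, q) ∈ E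

/-- A dynamic network of `n` agents; `G t` is the multigraph of links at round `t + 1`. -/
abbrev DynamicNetwork (n : ℕ) : Type := ℕ → Multigraph (Fin n)

namespace DynamicNetwork

variable {n : ℕ}

/-- The network is connected at every round. -/
def IsConnected (G : DynamicNetwork n) : Prop :=
  ∀ t, (G t).toSimpleGraph.Connected

/-- At every round, any two agents are joined by at most `M` parallel links. -/
def MultiplicityLE (G : DynamicNetwork n) (M : ℕ) : Prop :=
  ∀ t p q, (G t).count s(p, q) ≤ M

end DynamicNetwork

/-- A deterministic local algorithm for anonymous agents with inputs in `I` and outputs in `O`.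
All agents run the same algorithm. An agent can always read its own input, which is not part of
its (corruptible) internal state. The messages received in a round form a multiset: they carry no
order and no information on the sender. -/
structure LocalAlgorithm (I : Type u) (O : Type u) where
  /-- the internal states of an agent -/
  State : Type u
  /-- the messages -/
  Message : Type u
  /-- the proper initial state, determined by the input -/
  init : I → State
  /-- the message sent through all incident links -/
  send : I → State → Message
  /-- the new state, from the input, the current state and the received messages -/
  update : I → State → Multiset Message → State
  /-- the output returned at the end of a round -/
  output : I → State → O

namespace LocalAlgorithm

variable {I O : Type u} {n : ℕ}

/-- The messages received by agent `p` through the links `E` when the agents have inputs `x` and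
states `s`: for every agent `q`, one copy of the message of `q` for each link between `p` and
`q`. -/
def received (A : LocalAlgorithm I O) (E : Multigraph (Fin n)) (x : Fin n → I)
    (s : Fin n → A.State) (p : Fin n) : Multiset A.Message :=
  ∑ q, E.count s(p, q) • {A.send (x q) (s q)}

/-- The states of all agents at the end of round `t`, in the execution on `G` with inputs `x` in
which the states at the end of round `0` are `s₀`. -/
def state (A : LocalAlgorithm I O) (G : DynamicNetwork n) (x : Fin n → I)
    (s₀ : Fin n → A.State) : ℕ → Fin n → A.State
  | 0 => s₀
  | t + 1 => fun p =>
      A.update (x p) (A.state G x s₀ t p) (A.received (G t) x (A.state G x s₀ t) p)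

/-- The output of agent `p` at the end of round `t`. -/
def outputAt (A : LocalAlgorithm I O) (G : DynamicNetwork n) (x : Fin n → I)
    (s₀ : Fin n → A.State) (t : ℕ) (p : Fin n) : O :=
  A.output (x p) (A.state G x s₀ t p)

/-- The algorithm computes the function `φ` of the inputs in a self-stabilizing manner in all
connected dynamic networks of `n` agents, and stabilizes in at most `T` rounds: for all inputs and
all (possibly corrupted) initial states, from round `T` on the output of every agent is the
correct one. -/
def SelfStabilizesIn (A : LocalAlgorithm I O) (n : ℕ) (φ : (Fin n → I) → O) (T : ℕ) : Prop :=
  ∀ (G : DynamicNetwork n), G.IsConnected → ∀ (x : Fin n → I) (s₀ : Fin n → A.State),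
    ∀ t ≥ T, ∀ p, A.outputAt G x s₀ t p = φ x

/-- The states in `F` can be encoded, without ambiguity, by at most `b` bits each. -/
def EncodableInBits (A : LocalAlgorithm I O) (F : Set A.State) (b : ℕ) : Prop :=
  ∃ enc : A.State → List Bool, Set.InjOn enc F ∧ ∀ s ∈ F, (enc s).length ≤ b

/-- The algorithm is finite-state in connected networks of `n` agents. For every bound `M` on the
number of parallel links and every finite set `J` of inputs there is a set `F` of states, each
encodable in at most `f M |J|` bits, such that in all networks with multiplicities at most `M` and
inputs in `J`:
* the proper initial states are in `F`, and an execution that starts in `F` never leaves `F`;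
* whatever the initial states are, all states are in `F` from round `T` on. -/
def FiniteState (A : LocalAlgorithm I O) (n : ℕ) (f : ℕ → ℕ → ℕ) (T : ℕ) : Prop :=
  ∀ (M : ℕ) (J : Finset I), ∃ F : Set A.State,
    A.EncodableInBits F (f M J.card) ∧
    (∀ a ∈ J, A.init a ∈ F) ∧
    ∀ (G : DynamicNetwork n), G.IsConnected → G.MultiplicityLE M →
      ∀ (x : Fin n → I), (∀ p, x p ∈ J) → ∀ (s₀ : Fin n → A.State),
        ((∀ p, s₀ p ∈ F) → ∀ t p, A.state G x s₀ t p ∈ F) ∧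
        (∀ t ≥ T, ∀ p, A.state G x s₀ t p ∈ F)

end LocalAlgorithm

/-- The Input Frequency function: the fraction of agents that have each input value. -/
noncomputable def inputFrequency {I : Type u} {n : ℕ} (x : Fin n → I) : I → ℚ :=
  fun a => (Nat.card {p : Fin n // x p = a} : ℚ) / n

end AnonymousNetwork

namespace AnonymousNetwork

/-! Two connected networks of size `n` in which the same view occurs after `2n - 2` rounds have the
same input frequencies. Information reaches everybody in `n - 1` rounds, so this view fixes the set
of views after any `k ≤ n - 1` rounds (`view_mem_range`). If the inputs are not all equal, there are
at least two classes of views at round `0` and never more than `n`, so from some round `k ≤ n - 2`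
to the next no class splits (`exists_view_succ_factorsThrough`). The classes then form an equitable
partition for the links of round `k + 1`, with the same quotient matrix in both networks. Double
counting of links gives the ratios of the sizes of adjacent classes, connectedness all ratios, and
the total `n` the sizes (`card_fiber_eq`).

The algorithm keeps records of every length up to `2n - 2`. Length `k + 1` is rebuilt from length
`k`, so corrupted data is flushed, and only finitely many records are possible once `M` and `J` are
fixed. -/

/-- The possible records of the last `k` rounds seen by an agent: its own previous record and the
multiset of inputs and previous records received in the last round. -/
def History (I : Type u) : ℕ → Type u
  | 0 => PUnit
  | k + 1 => History I k × Multiset (I × History I k)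

/-! ### Views: how fast they spread and split. -/

section Views

variable {I : Type u} {n : ℕ}

/-- The record of agent `p` after the first `k` rounds of the network `G` with inputs `x`. -/
def history (G : DynamicNetwork n) (x : Fin n → I) : ∀ k, Fin n → History I k
  | 0, _ => PUnit.unit
  | k + 1, p => (history G x k p, ∑ q, (G k).count s(p, q) • {(x q, history G x k q)})

/-- The view of agent `p` after `k` rounds: its input and its record. -/
def view (G : DynamicNetwork n) (x : Fin n → I) (k : ℕ) (p : Fin n) : I × History I k :=
  (x p, history G x k p)

/-- The views received by agent `p` in round `k + 1`. -/
theorem history_succ_snd (G : DynamicNetwork n) (x : Fin n → I) (k : ℕ) (p : Fin n) :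
    (history G x (k + 1) p).2 = ∑ q, (G k).count s(p, q) • {view G x k q} := rfl

/-- Link counts into a class of views are part of the next view: these are the quotient matrix
entries. -/
theorem count_history_succ_snd [∀ k, DecidableEq (I × History I k)] (G : DynamicNetwork n)
    (x : Fin n → I) (k : ℕ) (p : Fin n) (B : I × History I k) :
    Multiset.count B (history G x (k + 1) p).2 =
      ∑ q with view G x k q = B, (G k).count s(p, q) := by
  rw [history_succ_snd, Multiset.count_sum', Finset.sum_filter]
  refine Finset.sum_congr rfl fun q _ => ?_
  rw [Multiset.count_nsmul, Multiset.count_singleton]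
  by_cases h : view G x k q = B
  · simp [h]
  · simp [h, Ne.symm h]

theorem view_eq_of_view_succ_eq {n' : ℕ} {G : DynamicNetwork n} {G' : DynamicNetwork n'}
    {x : Fin n → I} {x' : Fin n' → I} {k : ℕ} {p : Fin n} {p' : Fin n'}
    (h : view G x (k + 1) p = view G' x' (k + 1) p') : view G x k p = view G' x' k p' :=
  congrArg (fun v => (v.1, v.2.1)) h

theorem count_pos_of_adj {E : Multigraph (Fin n)} {p q : Fin n} (h : E.toSimpleGraph.Adj p q) :
    0 < E.count s(p, q) := by
  rw [Multiset.count_pos]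
  rcases (SimpleGraph.fromRel_adj _ _ _).1 h with ⟨-, h | h⟩
  · exact h
  · rwa [Sym2.eq_swap]

/-- The neighbors of an agent whose view occurs in `G'` have views that occur in `G'`. -/
theorem view_mem_range_of_adj {n' : ℕ} {G : DynamicNetwork n} {G' : DynamicNetwork n'}
    {x : Fin n → I} {x' : Fin n' → I} {k : ℕ} {p q : Fin n}
    (hp : view G x (k + 1) p ∈ Set.range (view G' x' (k + 1)))
    (hpq : (G k).toSimpleGraph.Adj p q) : view G x k q ∈ Set.range (view G' x' k) := by
  obtain ⟨p', hp'⟩ := hp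
  have hm : view G x k q ∈ (history G x (k + 1) p).2 := by
    rw [history_succ_snd, Multiset.mem_sum]
    exact ⟨q, Finset.mem_univ q, by
      rw [Multiset.mem_nsmul]
      exact ⟨(count_pos_of_adj hpq).ne', Multiset.mem_singleton_self _⟩⟩
  have hE : (history G' x' (k + 1) p').2 = (history G x (k + 1) p).2 :=
    congrArg (fun v => v.2.2) hp'
  rw [← hE, history_succ_snd, Multiset.mem_sum] at hm
  obtain ⟨q', -, hq'⟩ := hm
  rw [Multiset.mem_nsmul] at hq'
  exact ⟨q', (Multiset.mem_singleton.1 hq'.2).symm⟩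

/-- In a connected graph, a nonempty proper set of vertices has a neighbor outside it. -/
theorem exists_adj_of_connected {V : Type*} {H : SimpleGraph V} (hH : H.Connected) {S : Set V}
    {p q : V} (hp : p ∈ S) (hq : q ∉ S) : ∃ a ∈ S, ∃ b ∉ S, H.Adj a b := by
  obtain ⟨w⟩ := hH.preconnected p q
  obtain ⟨d, -, h₁, h₂⟩ := w.exists_boundary_dart S hp hq
  exact ⟨d.fst, h₁, d.snd, h₂, d.adj⟩

/-- If a view after `k + d` rounds occurs in both networks, then so do at least `d + 1` views of
the agents of the first network after `k` rounds, or all of them. -/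
theorem card_view_mem_range {n' : ℕ} {G : DynamicNetwork n} (hG : G.IsConnected)
    {G' : DynamicNetwork n'} {x : Fin n → I} {x' : Fin n' → I} (d : ℕ) :
    ∀ k, (∃ p, view G x (k + d) p ∈ Set.range (view G' x' (k + d))) →
      (∀ p, view G x k p ∈ Set.range (view G' x' k)) ∨
        d + 1 ≤ {p | view G x k p ∈ Set.range (view G' x' k)}.ncard := by
  induction d with
  | zero =>
    rintro k ⟨p, hp⟩
    exact .inr ((Set.ncard_pos (Set.toFinite _)).2 ⟨p, hp⟩)
  | succ d ih =>
    intro k hk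
    rw [show k + (d + 1) = k + 1 + d by ring] at hk
    have hsub : {p | view G x (k + 1) p ∈ Set.range (view G' x' (k + 1))} ⊆
        {p | view G x k p ∈ Set.range (view G' x' k)} := by
      rintro p ⟨p', hp'⟩
      exact ⟨p', view_eq_of_view_succ_eq hp'⟩
    rcases ih (k + 1) hk with h | h
    · exact .inl fun p => hsub (h p)
    · by_cases hall : ∀ p, view G x (k + 1) p ∈ Set.range (view G' x' (k + 1))
      · exact .inl fun p => hsub (hall p)
      push Not at hall
      obtain ⟨q, hq⟩ := hall
      obtain ⟨p, hp⟩ := (Set.ncard_pos (Set.toFinite _)).1 ((Nat.succ_pos d).trans_le h)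
      -- `b` sends its view to `a`, whose next view is shared, so the view of `b` is shared after
      -- `k` rounds but no longer after `k + 1`: the inclusion is strict.
      obtain ⟨a, ha, b, hb, hab⟩ := exists_adj_of_connected (hG k) hp hq
      refine .inr (Nat.succ_le_of_lt (h.trans_lt ?_))
      exact Set.ncard_lt_ncard
        ⟨hsub, fun hs => hb (hs (view_mem_range_of_adj ha hab))⟩ (Set.toFinite _)

/-- A view after `k + (n - 1)` rounds determines the set of all views after `k` rounds. -/
theorem view_mem_range {n' : ℕ} {G : DynamicNetwork n} (hG : G.IsConnected)
    {G' : DynamicNetwork n'} {x : Fin n → I} {x' : Fin n' → I} {k m : ℕ} (hm : k + (n - 1) ≤ m)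
    {p : Fin n} {p' : Fin n'} (h : view G x m p = view G' x' m p') (q : Fin n) :
    view G x k q ∈ Set.range (view G' x' k) := by
  obtain ⟨d, rfl⟩ := Nat.exists_eq_add_of_le ((Nat.le_add_right _ _).trans hm)
  rcases card_view_mem_range hG d k ⟨p, p', h.symm⟩ with h | h
  · exact h q
  · have hu : {p | view G x k p ∈ Set.range (view G' x' k)} = Set.univ := by
      refine Set.eq_of_subset_of_ncard_le (Set.subset_univ _) ?_ (Set.toFinite _)
      rw [Set.ncard_univ, Nat.card_fin]
      omega
    exact Set.eq_univ_iff_forall.1 hu q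

/-- If two inputs differ, then in one of the rounds `1, …, n - 1` no class of agents with the same
view splits. -/
theorem exists_view_succ_factorsThrough {G : DynamicNetwork n} {x : Fin n → I} {p q : Fin n}
    (hpq : x p ≠ x q) :
    ∃ k, k + 2 ≤ n ∧ (view G x (k + 1)).FactorsThrough (view G x k) := by
  by_contra! hcon
  -- If some class split in every round, the `2` initial classes would become `n + 1` after `n - 1`
  -- rounds.
  have key : ∀ k, k + 1 ≤ n → k + 2 ≤ (Set.range (view G x k)).ncard := by
    intro k
    induction k with
    | zero =>
      intro _
      have : ({view G x 0 p, view G x 0 q} : Set _).ncard = 2 :=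
        Set.ncard_pair fun h => hpq (congrArg Prod.fst h)
      rw [zero_add, ← this]
      refine Set.ncard_le_ncard ?_ (Set.finite_range _)
      rintro _ (rfl | rfl) <;> exact Set.mem_range_self _
    | succ k ih =>
      intro hk
      refine Nat.succ_le_of_lt ((ih (by omega)).trans_lt ?_)
      let π : I × History I (k + 1) → I × History I k := fun v => (v.1, v.2.1)
      have himg : Set.range (view G x k) = π '' Set.range (view G x (k + 1)) := by
        rw [← Set.range_comp]; rfl
      rw [himg]
      refine (Set.ncard_image_le (Set.finite_range _)).lt_of_ne fun he => ?_
      have hinj := (Set.ncard_image_iff (Set.finite_range _)).1 he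
      exact hcon k (by omega) fun a b hab =>
        hinj (Set.mem_range_self a) (Set.mem_range_self b) hab
  have hn : 1 ≤ n := Nat.one_le_iff_ne_zero.2 (by rintro rfl; exact p.elim0)
  have h₁ := key (n - 1) (by omega)
  have h₂ : (Set.range (view G x (n - 1))).ncard ≤ n := by
    rw [← Set.image_univ]
    refine (Set.ncard_image_le Set.finite_univ).trans ?_
    rw [Set.ncard_univ, Nat.card_fin]
  omega

end Views

/-! ### Equitable partitions and class sizes. -/

section Counting

variable {V N : Type*} [Fintype V] [DecidableEq N]

/-- Double counting of the links between two classes of an equitable partition. -/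
theorem card_fiber_mul_eq {φ : V → N} {w : V → V → ℕ} (hw : ∀ p q, w p q = w q p)
    {m : N → N → ℕ} (hm : ∀ p B, ∑ q with φ q = B, w p q = m (φ p) B) (A B : N) :
    Finset.card {p | φ p = A} * m A B = Finset.card {p | φ p = B} * m B A := by
  have h : ∀ A B, Finset.card {p | φ p = A} * m A B =
      ∑ p with φ p = A, ∑ q with φ q = B, w p q := fun A B => by
    rw [Finset.sum_congr rfl (g := fun _ => m A B), Finset.sum_const, smul_eq_mul]
    intro p hp
    rw [hm, (Finset.mem_filter.1 hp).2]
  rw [h, h, Finset.sum_comm]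
  exact Finset.sum_congr rfl fun q _ => Finset.sum_congr rfl fun p _ => hw p q

/-- Two equitable partitions with the same classes and the same quotient matrix, the first of them
on a connected graph, have classes of the same sizes. -/
theorem card_fiber_eq {φ φ' : V → N} {w w' : V → V → ℕ} (hw : ∀ p q, w p q = w q p)
    (hw' : ∀ p q, w' p q = w' q p) {m : N → N → ℕ}
    (hm : ∀ p B, ∑ q with φ q = B, w p q = m (φ p) B)
    (hm' : ∀ p B, ∑ q with φ' q = B, w' p q = m (φ' p) B)
    (hφ : Set.range φ = Set.range φ') {H : SimpleGraph V} (hH : H.Connected)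
    (hpos : ∀ p q, H.Adj p q → 0 < w p q) (A : N) :
    Finset.card {p | φ p = A} = Finset.card {p | φ' p = A} := by
  set c : N → ℕ := fun A => Finset.card {p | φ p = A} with hc
  set c' : N → ℕ := fun A => Finset.card {p | φ' p = A} with hc'
  have hcpos : ∀ p, 0 < c (φ p) := fun p => Finset.card_pos.2 ⟨p, by simp⟩
  have hmpos : ∀ p q, H.Adj p q → 0 < m (φ p) (φ q) := fun p q hpq => by
    rw [← hm]
    exact (hpos p q hpq).trans_le
      (Finset.single_le_sum (f := w p) (fun _ _ => Nat.zero_le _) (by simp))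
  -- Both size ratios equal the same ratio of entries of `m`; cross-multiplication avoids division.
  have hadj : ∀ p q, H.Adj p q → c (φ p) * c' (φ q) = c' (φ p) * c (φ q) := fun p q hpq => by
    have h₁ : c (φ p) * m (φ p) (φ q) = c (φ q) * m (φ q) (φ p) := card_fiber_mul_eq hw hm _ _
    have h₂ : c' (φ p) * m (φ p) (φ q) = c' (φ q) * m (φ q) (φ p) :=
      card_fiber_mul_eq hw' hm' _ _
    refine Nat.eq_of_mul_eq_mul_right (hmpos q p hpq.symm) ?_
    rw [mul_assoc, ← h₂, mul_assoc, ← h₁]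
    ring
  obtain ⟨p₀⟩ := hH.nonempty
  have hall : ∀ q, c (φ p₀) * c' (φ q) = c' (φ p₀) * c (φ q) := fun q => by
    obtain ⟨W⟩ := hH.preconnected q p₀
    induction W with
    | nil => ring
    | @cons u v p₀ h _ ih =>
      refine Nat.eq_of_mul_eq_mul_right (hcpos v) ?_
      rw [mul_assoc, ← hadj u v h, mul_left_comm, ih]
      ring
  have himg : Finset.univ.image φ = Finset.univ.image φ' := by
    rw [← Finset.coe_inj]; simpa using hφ
  have hsum : ∑ B ∈ Finset.univ.image φ, c B = Fintype.card V :=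
    (Finset.card_eq_sum_card_image φ Finset.univ).symm
  have hsum' : ∑ B ∈ Finset.univ.image φ, c' B = Fintype.card V := by
    rw [himg]; exact (Finset.card_eq_sum_card_image φ' Finset.univ).symm
  -- All ratios `c / c'` agree and both sizes sum to `Fintype.card V`, so the common ratio is `1`.
  have h₀ : c (φ p₀) = c' (φ p₀) := by
    refine Nat.eq_of_mul_eq_mul_right (Fintype.card_pos_iff.2 ⟨p₀⟩ : 0 < Fintype.card V) ?_
    nth_rewrite 1 [← hsum']
    rw [← hsum, Finset.mul_sum, Finset.mul_sum]
    refine Finset.sum_congr rfl fun B hB => ?_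
    obtain ⟨q, -, rfl⟩ := Finset.mem_image.1 hB
    exact hall q
  change c A = c' A
  by_cases hA : A ∈ Set.range φ
  · obtain ⟨q, rfl⟩ := hA
    have := hall q
    rw [← h₀] at this
    exact (Nat.eq_of_mul_eq_mul_left (hcpos p₀) this).symm
  · have hA' := hA
    rw [hφ] at hA'
    rw [hc, hc']
    simp only
    rw [Finset.card_eq_zero.2, Finset.card_eq_zero.2]
    · exact Finset.filter_eq_empty_iff.2 fun p _ h => hA' ⟨p, h⟩
    · exact Finset.filter_eq_empty_iff.2 fun p _ h => hA ⟨p, h⟩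

end Counting

/-! ### From views to input frequencies. -/

section Frequency

variable {I : Type u} {n : ℕ}

theorem inputFrequency_eq_of_card_fiber_eq {N : Type*} [DecidableEq N] {x x' : Fin n → I}
    {φ φ' : Fin n → N} {π : N → I} (hx : ∀ p, π (φ p) = x p) (hx' : ∀ p, π (φ' p) = x' p)
    (h : ∀ A, Finset.card {p | φ p = A} = Finset.card {p | φ' p = A}) :
    inputFrequency x = inputFrequency x' := by
  classical
  have hmap : Finset.univ.val.map φ = Finset.univ.val.map φ' := by
    ext A
    rw [Multiset.count_map, Multiset.count_map]
    simpa only [eq_comm, Finset.card_def, Finset.filter_val] using h A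
  have hmap' : Finset.univ.val.map x = Finset.univ.val.map x' := by
    have := congrArg (Multiset.map π) hmap
    simpa only [Multiset.map_map, Function.comp_def, hx, hx'] using this
  funext a
  have := congrArg (Multiset.count a) hmap'
  rw [Multiset.count_map, Multiset.count_map] at this
  unfold inputFrequency
  rw [Nat.card_eq_fintype_card, Nat.card_eq_fintype_card, Fintype.card_subtype,
    Fintype.card_subtype]
  simp only [Finset.card_def, Finset.filter_val, eq_comm (b := a), this]

/-- In connected networks of `n` agents, a view after `2n - 2` rounds determines the input
frequencies. -/
theorem inputFrequency_eq_of_view_eq {G G' : DynamicNetwork n} (hG : G.IsConnected)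
    (hG' : G'.IsConnected) {x x' : Fin n → I} {p p' : Fin n}
    (h : view G x (2 * n - 2) p = view G' x' (2 * n - 2) p') :
    inputFrequency x = inputFrequency x' := by
  classical
  -- Equal inputs are treated apart: with a single initial class, the splitting argument would need
  -- one more round.
  by_cases hx : ∀ q, x q = x p
  · have hx' : x' = x := funext fun q => by
      obtain ⟨r, hr⟩ := view_mem_range (k := 0) hG' (by omega) h.symm q
      rw [hx q, ← hx r]
      exact (congrArg Prod.fst hr).symm
    rw [hx']
  push Not at hx
  obtain ⟨q, hq⟩ := hx
  obtain ⟨k, hk, hfac⟩ := exists_view_succ_factorsThrough (G := G) hq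
  have hsub := view_mem_range (k := k) hG (by omega) h
  -- Here `k + 1 + (n - 1) ≤ 2 * n - 2`, by `k + 2 ≤ n`; this is the origin of the stabilization
  -- time.
  have hsub' := view_mem_range (k := k + 1) hG' (by omega) h.symm
  have hsub₀ : ∀ r, view G' x' k r ∈ Set.range (view G x k) := fun r => by
    obtain ⟨s, hs⟩ := hsub' r
    exact ⟨s, view_eq_of_view_succ_eq hs⟩
  have : Nonempty (I × History I (k + 1)) := ⟨view G x (k + 1) p⟩
  obtain ⟨g, hg⟩ := (Function.factorsThrough_iff _).1 hfac
  have hg₁ : ∀ r, view G x (k + 1) r = g (view G x k r) := fun r => congrFun hg r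
  -- Every view of `G'` after `k + 1` rounds occurs in `G`, so the same `g` governs both networks.
  have hg₂ : ∀ r, view G' x' (k + 1) r = g (view G' x' k r) := fun r => by
    obtain ⟨s, hs⟩ := hsub' r
    rw [← hs, hg₁, view_eq_of_view_succ_eq hs]
  refine inputFrequency_eq_of_card_fiber_eq (φ := view G x k) (φ' := view G' x' k) (π := Prod.fst)
    (fun _ => rfl) (fun _ => rfl) fun A =>
      card_fiber_eq (w := fun r s => (G k).count s(r, s)) (w' := fun r s => (G' k).count s(r, s))
        (m := fun A B => Multiset.count B (g A).2.2) ?_ ?_ ?_ ?_ ?_ (hG k) ?_ A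
  · intro r s
    rw [Sym2.eq_swap]
  · intro r s
    rw [Sym2.eq_swap]
  · intro r B
    rw [← hg₁]
    exact (count_history_succ_snd G x k r B).symm
  · intro r B
    rw [← hg₂]
    exact (count_history_succ_snd G' x' k r B).symm
  · exact Set.Subset.antisymm (Set.range_subset_iff.2 hsub) (Set.range_subset_iff.2 hsub₀)
  · exact fun r s hrs => count_pos_of_adj hrs

end Frequency

/-! ### The algorithm and its self-stabilization. -/

section Algorithm

variable {I : Type u} {n : ℕ}

/-- The record of an agent that has received nothing. -/
def emptyHistory (I : Type u) : ∀ k, History I k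
  | 0 => PUnit.unit
  | k + 1 => (emptyHistory I k, 0)

/-- The new records, of all lengths up to `L`, from the previous ones and those received. -/
def updateRecords (L : ℕ) (s : ∀ k : Fin (L + 1), History I k)
    (ms : Multiset (I × ∀ k : Fin (L + 1), History I k)) : ∀ k : Fin (L + 1), History I k
  | ⟨0, _⟩ => PUnit.unit
  | ⟨k + 1, h⟩ => (s ⟨k, (Nat.lt_succ_self k).trans h⟩,
      ms.map fun m => (m.1, m.2 ⟨k, (Nat.lt_succ_self k).trans h⟩))

open Classical in
/-- The input frequencies in some connected network of `n` agents where the given view occurs. -/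
noncomputable def frequencyOfView (n : ℕ) {L : ℕ} (v : I × History I L) : I → ℚ :=
  if h : ∃ x : Fin n → I, ∃ G : DynamicNetwork n, G.IsConnected ∧ ∃ p, view G x L p = v then
    inputFrequency h.choose
  -- Junk value, reached only for views that occur in no connected network of size `n`.
  else 0

theorem frequencyOfView_view {G : DynamicNetwork n} (hG : G.IsConnected) (x : Fin n → I)
    (p : Fin n) : frequencyOfView n (view G x (2 * n - 2) p) = inputFrequency x := by
  have h : ∃ x' : Fin n → I, ∃ G' : DynamicNetwork n, G'.IsConnected ∧
      ∃ p', view G' x' (2 * n - 2) p' = view G x (2 * n - 2) p := ⟨x, G, hG, p, rfl⟩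
  rw [frequencyOfView, dif_pos h]
  obtain ⟨G', hG', p', hp'⟩ := h.choose_spec
  exact inputFrequency_eq_of_view_eq hG' hG hp'

/-- Every agent keeps its records of the last `0, …, 2n - 2` rounds, and sends them with its
input. -/
noncomputable def frequencyAlgorithm (I : Type u) (n : ℕ) : LocalAlgorithm I (I → ℚ) where
  State := ∀ k : Fin (2 * n - 2 + 1), History I k
  Message := I × ∀ k : Fin (2 * n - 2 + 1), History I k
  init _ := fun k => emptyHistory I k
  send a s := (a, s)
  update _ s ms := updateRecords _ s ms
  output a s := frequencyOfView n (a, s (Fin.last _))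

theorem state_succ_apply_succ (G : DynamicNetwork n) (x : Fin n → I)
    (s₀ : Fin n → (frequencyAlgorithm I n).State) (t : ℕ) (p : Fin n) (k : ℕ)
    (hk : k + 1 < 2 * n - 2 + 1) :
    (frequencyAlgorithm I n).state G x s₀ (t + 1) p ⟨k + 1, hk⟩ =
      ((frequencyAlgorithm I n).state G x s₀ t p ⟨k, (Nat.lt_succ_self k).trans hk⟩,
        ∑ q, (G t).count s(p, q) • {(x q, (frequencyAlgorithm I n).state G x s₀ t q
          ⟨k, (Nat.lt_succ_self k).trans hk⟩)}) := by
  refine Prod.ext rfl ?_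
  change Multiset.map _ (∑ q, (G t).count s(p, q) • {_}) = _
  rw [← Multiset.coe_mapAddMonoidHom, map_sum]
  exact Finset.sum_congr rfl fun q _ => Multiset.map_nsmul _ _ _

/-- After `k` rounds, the records of length `k` are correct. -/
theorem state_add_eq_history (G : DynamicNetwork n) (x : Fin n → I)
    (s₀ : Fin n → (frequencyAlgorithm I n).State) (t k : ℕ) (hk : k < 2 * n - 2 + 1)
    (p : Fin n) : (frequencyAlgorithm I n).state G x s₀ (t + k) p ⟨k, hk⟩ =
      history (fun i => G (t + i)) x k p := by
  induction k generalizing p with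
  | zero => rfl
  | succ k ih =>
    rw [← add_assoc, state_succ_apply_succ]
    simp only [ih]
    rfl

/-- The longest record sees only the last `2n - 2` rounds, so it is a genuine record of the network
shifted in time. -/
theorem frequencyAlgorithm_selfStabilizesIn (I : Type u) (n : ℕ) :
    (frequencyAlgorithm I n).SelfStabilizesIn n inputFrequency (2 * n - 2) := by
  intro G hG x s₀ t ht p
  obtain ⟨t, rfl⟩ := Nat.exists_eq_add_of_le' ht
  rw [← frequencyOfView_view (G := fun i => G (t + i)) (fun i => hG _) x p]
  exact congrArg (fun v => frequencyOfView n (x p, v)) (state_add_eq_history G x s₀ t _ _ p)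

end Algorithm

/-! ### Bounds on the states. -/

section FiniteState

variable {I : Type u} {n : ℕ}

/-- A bound for the number of records of `k` rounds with `j` inputs and `C` copies of every
message. -/
def historyBound (C j : ℕ) : ℕ → ℕ
  | 0 => 1
  | k + 1 => historyBound C j k * 2 ^ (C * (j * historyBound C j k))

open Classical in
/-- The records of `k` rounds with inputs in `J` and at most `C` copies of every message. -/
noncomputable def boundedHistories (C : ℕ) (J : Finset I) : ∀ k, Finset (History I k)
  | 0 => {PUnit.unit}
  | k + 1 => boundedHistories C J k ×ˢ
      (C • (J ×ˢ boundedHistories C J k).val).powerset.toFinset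

theorem card_boundedHistories_le (C : ℕ) (J : Finset I) (k : ℕ) :
    (boundedHistories C J k).card ≤ historyBound C J.card k := by
  classical
  induction k with
  | zero => exact le_rfl
  | succ k ih =>
    refine (Finset.card_product _ _).trans_le ?_
    refine Nat.mul_le_mul ih ((Multiset.toFinset_card_le _).trans ?_)
    rw [Multiset.card_powerset, Multiset.card_nsmul, Finset.card_val, Finset.card_product]
    gcongr
    norm_num

theorem mem_boundedHistories_succ {C : ℕ} {J : Finset I} {k : ℕ} {v : History I (k + 1)} :
    v ∈ boundedHistories C J (k + 1) ↔ v.1 ∈ boundedHistories C J k ∧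
      v.2 ≤ C • (J ×ˢ boundedHistories C J k).val := by
  classical
  refine Finset.mem_product.trans (and_congr_right fun _ => ?_)
  rw [Multiset.mem_toFinset, Multiset.mem_powerset]

theorem emptyHistory_mem_boundedHistories (C : ℕ) (J : Finset I) (k : ℕ) :
    emptyHistory I k ∈ boundedHistories C J k := by
  induction k with
  | zero => exact Finset.mem_singleton_self _
  | succ k ih => exact mem_boundedHistories_succ.2 ⟨ih, Multiset.zero_le _⟩

/-- Each of the `n` agents sends at most `M` copies of its message, whence the multiplicity bound `n
* M`. -/
theorem mk_sum_mem_boundedHistories {E : Multigraph (Fin n)} {M : ℕ} {J : Finset I}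
    {x : Fin n → I} (hx : ∀ p, x p ∈ J) {p : Fin n} (hE : ∀ q, E.count s(p, q) ≤ M) {k : ℕ}
    {h : Fin n → History I k} (hh : ∀ q, h q ∈ boundedHistories (n * M) J k) :
    ((h p, ∑ q, E.count s(p, q) • {(x q, h q)}) : History I (k + 1)) ∈
      boundedHistories (n * M) J (k + 1) := by
  refine mem_boundedHistories_succ.2 ⟨hh p, ?_⟩
  calc ∑ q, E.count s(p, q) • ({(x q, h q)} : Multiset (I × History I k))
      ≤ ∑ _q : Fin n, M • (J ×ˢ boundedHistories (n * M) J k).val := by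
        refine Finset.sum_le_sum fun q _ => ?_
        refine (nsmul_le_nsmul_left (Multiset.zero_le _) (hE q)).trans
          (nsmul_le_nsmul_right ?_ M)
        exact Multiset.singleton_le.2 (Finset.mk_mem_product (hx q) (hh q))
    _ = (n * M) • (J ×ˢ boundedHistories (n * M) J k).val := by
        rw [Finset.sum_const, Finset.card_univ, Fintype.card_fin, mul_nsmul']

/-- The encoding is unary: a state is the string of length its index in `F`. Any bound suffices, so
no logarithm is taken. -/
theorem encodableInBits_of_card_le {O : Type u} (A : LocalAlgorithm I O) (F : Finset A.State)
    {b : ℕ} (hb : F.card ≤ b) : A.EncodableInBits F b := by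
  classical
  refine ⟨fun s => if h : s ∈ F then List.replicate (F.equivFin ⟨s, h⟩) true else [], ?_, ?_⟩
  · intro s hs s' hs' h
    have hs : s ∈ F := hs
    have hs' : s' ∈ F := hs'
    simp only [dif_pos hs, dif_pos hs'] at h
    have := congrArg List.length h
    rw [List.length_replicate, List.length_replicate, Fin.val_inj] at this
    exact congrArg Subtype.val (F.equivFin.injective this)
  · intro s hs
    have hs : s ∈ F := hs
    simp only [dif_pos hs, List.length_replicate]
    exact (F.equivFin _).is_lt.le.trans hb

theorem frequencyAlgorithm_finiteState (I : Type u) (n : ℕ) :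
    (frequencyAlgorithm I n).FiniteState n
      (fun M j => ∏ k : Fin (2 * n - 2 + 1), historyBound (n * M) j k) (2 * n - 2) := by
  intro M J
  let F : Finset (frequencyAlgorithm I n).State :=
    Fintype.piFinset fun k => boundedHistories (n * M) J k
  have hF : ∀ s, s ∈ F ↔ ∀ k : Fin (2 * n - 2 + 1), s k ∈ boundedHistories (n * M) J k :=
    fun s => Fintype.mem_piFinset
  refine ⟨↑F, encodableInBits_of_card_le (frequencyAlgorithm I n) F ?_,
    fun a _ => (hF _).2 fun k => emptyHistory_mem_boundedHistories _ _ _, ?_⟩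
  · refine (Fintype.card_piFinset _).trans_le ?_
    exact Finset.prod_le_prod' fun k _ => card_boundedHistories_le _ _ _
  intro G _ hM x hx s₀
  refine ⟨fun h₀ t => ?_, fun t ht p => (hF _).2 ?_⟩
  · induction t with
    | zero => exact h₀
    | succ t ih =>
      refine fun p => (hF _).2 ?_
      rintro ⟨_ | k, hk⟩
      · exact Finset.mem_singleton_self _
      · rw [state_succ_apply_succ]
        exact mk_sum_mem_boundedHistories hx (hM t p) fun q =>
          (hF _).1 (ih q) ⟨k, (Nat.lt_succ_self k).trans hk⟩
  -- Nothing is assumed of the initial states: a record of length `k` depends only on the inputs and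
  -- links of the last `k` rounds.
  · have key : ∀ k (hk : k < 2 * n - 2 + 1) t p,
        (frequencyAlgorithm I n).state G x s₀ (t + k) p ⟨k, hk⟩ ∈
          boundedHistories (n * M) J k := by
      intro k
      induction k with
      | zero => exact fun _ _ _ => Finset.mem_singleton_self _
      | succ k ih =>
        intro hk t p
        rw [← add_assoc, state_succ_apply_succ]
        exact mk_sum_mem_boundedHistories hx (hM _ p) fun q => ih _ t q
    rintro ⟨k, hk⟩
    obtain ⟨t, rfl⟩ := Nat.exists_eq_add_of_le' ((Nat.le_of_lt_succ hk).trans ht)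
    exact key k hk t p

end FiniteState

end AnonymousNetwork

theorem theorem1 :
    ∃ f : ℕ → ℕ → ℕ → ℕ, ∀ n : ℕ, 1 ≤ n → ∀ I : Type u,
      ∃ A : AnonymousNetwork.LocalAlgorithm I (I → ℚ),
        A.SelfStabilizesIn n AnonymousNetwork.inputFrequency (2 * n - 2) ∧
        A.FiniteState n (f n) (2 * n - 2) :=
  ⟨fun n M j => ∏ k : Fin (2 * n - 2 + 1), AnonymousNetwork.historyBound (n * M) j k,
    fun n _ I => ⟨AnonymousNetwork.frequencyAlgorithm I n,
      AnonymousNetwork.frequencyAlgorithm_selfStabilizesIn I n,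
      AnonymousNetwork.frequencyAlgorithm_finiteState I n⟩⟩
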